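/- **Setting.** A base station at the origin of the plane serves one grant-based (GB) user and $K\ge 1$ grant-free (GF) users. The GF users are placed independently and uniformly in the disc of radius $D_{\mathrm F}>0$ and the GB user uniformly in the ring with radii $0<D_0<D_1$. A user at distance $r$ has channel $\zeta/\sqrt{1+r^{\alpha}}$ with path loss exponent $\alpha>0$ and $\zeta\sim\mathcal{CN}(0,1)$; all locations and fading coefficients are independent. Write $h_1,\dots,h_K$ for the channels of the GF users, $g$ for that of the GB user, $P_{\mathrm B}>0$ for the power of the GB user, $P_m>0$ for the maximal power of the GF users; the noise variance is $1$. Let $R_{\mathrm B},R_{\mathrm F}>0$ be the target rates of the GB and GF users, $\gamma_{\mathrm B}=2^{R_{\mathrm B}}-1$, $\gamma_{\mathrm F}=2^{R_{\mathrm F}}-1$, $\alpha_{\mathrm B}=\gamma_{\mathrm B}/P_{\mathrm B}$, $\alpha_1=\alpha_{\mathrm B}(\gamma_{\mathrm F}+1)$ and $\tau_0=\max\{0,P_{\mathrm B}|g|^2/\gamma_{\mathrm B}-1\}$. **Scheme (BU-SGF-PC).** The $k$-th GF user chooses the power $$P_k=\begin{cases}\tau_0/|h_k|^2,&\text{if }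 \tau_0/P_m<|h_k|^2<\tau_0(1+P_{\mathrm B}|g|^2)/P_m,\\ P_m,&\text{otherwise,}\end{cases}$$ and its achievable rate is $\log_2\bigl(1+\tfrac{P_k|h_k|^2}{P_{\mathrm B}|g|^2+1}\bigr)$ if $P_k|h_k|^2>\tau_0$ and $\log_2(1+P_k|h_k|^2)$ if $P_k|h_k|^2\le\tau_0$. A GF user with the largest achievable rate is admitted. The outage probability $\mathcal P^{\mathrm{PC}}_{\mathrm{BU}}$ is the probability that the rate of the admitted user is smaller than $R_{\mathrm F}$. **Notation.** Let $$F_{\mathrm F}(x)=\tfrac{2}{D_{\mathrm F}^2}\int_0^{D_{\mathrm F}}\bigl[1-e^{-(1+r^\alpha)x}\bigr]r\,dr,\qquad F_{\mathrm B}(y)=\tfrac{2}{D_1^2-D_0^2}\int_{D_0}^{D_1}\bigl[1-e^{-(1+r^\alpha)y}\bigr]r\,dr,\qquad f_{\mathrm B}=F_{\mathrm B}'$$ be the distribution functions of the GF and GB channel gains and the density of the latter. Put $$\Lambda_k(w)=f_{\mathrm B}(w)\Bigl[F_{\mathrm F}\bigl(\tfrac{\alpha_{\mathrm B}^{-1}w-1}{P_m}\bigr)\Bigr]^k\Bigl[F_{\mathrm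 F}\bigl(\tfrac{\gamma_{\mathrm F}}{P_m}(P_{\mathrm B}w+1)\bigr)-F_{\mathrm F}\bigl(\tfrac{\alpha_{\mathrm B}^{-1}w-1}{P_m}\bigr)\Bigr]^{K-k},\qquad \Lambda(w)=f_{\mathrm B}(w)\Bigl[F_{\mathrm F}\bigl(\tfrac{\gamma_{\mathrm F}}{P_m}(P_{\mathrm B}w+1)\bigr)\Bigr]^{K}.$$ With $\theta_{n,i}=\cos\frac{(2i-1)\pi}{2n}$, let $Q_n(\varphi;a,b)=\frac{b-a}{2}\sum_{i=1}^n\frac{\pi}{n}\sqrt{1-\theta_{n,i}^2}\;\varphi\bigl(\frac{(b-a)\theta_{n,i}+a+b}{2}\bigr)$ be the Gaussian–Chebyshev quadrature sum with $n$ nodes for $\int_a^b\varphi$. Put $G_{1;k}=Q_I(\Lambda_k;\alpha_{\mathrm B},\alpha_1)$, $G_3=Q_M(\Lambda;0,\alpha_{\mathrm B})$ and $I_5=[1-F_{\mathrm B}(\alpha_1)]\,[F_{\mathrm F}(\gamma_{\mathrm F}/P_m)]^K$. **Theorem 3.** Without any condition on $\gamma_{\mathrm B}\gamma_{\mathrm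 F}$, the following hold. 1. Exactly, $$\mathcal P^{\mathrm{PC}}_{\mathrm{BU}}=\sum_{k=0}^{K}\binom Kk\int_{\alpha_{\mathrm B}}^{\alpha_1}\Lambda_k(w)\,dw+\int_0^{\alpha_{\mathrm B}}\Lambda(w)\,dw+I_5 .$$ 2. $\mathcal P^{\mathrm{PC}}_{\mathrm{BU}}\approx\sum_{k=0}^{K}\binom Kk G_{1;k}+G_3+I_5$, in the sense that the right-hand side converges to $\mathcal P^{\mathrm{PC}}_{\mathrm{BU}}$ as the numbers of nodes $I,M\to\infty$. 3. The same holds, as $I,M,L,N\to\infty$ jointly, if in $G_{1;k}$, $G_3$ and $I_5$ the functions $F_{\mathrm F}$, $F_{\mathrm B}$, $f_{\mathrm B}$ are replaced by their Gaussian–Chebyshev approximations $$F_{\mathrm F}(x)\approx\tfrac12\sum_{l=1}^L\Psi_l(1-e^{-\mu_l x}),\quad F_{\mathrm B}(y)\approx\tfrac{1}{D_1+D_0}\sum_{n=1}^N\Phi_n(1-e^{-c_ny}),\quad f_{\mathrm B}(y)\approx\tfrac{1}{D_1+D_0}\sum_{n=1}^N\Phi_nc_ne^{-c_ny},$$ where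 $\Psi_l=\frac{\pi}{L}\sqrt{1-\theta_{L,l}^2}\,(1+\theta_{L,l})$, $\mu_l=1+\bigl(\frac{D_{\mathrm F}}2+\frac{D_{\mathrm F}}2\theta_{L,l}\bigr)^\alpha$, $\phi_n=\frac{D_1+D_0}{2}+\frac{D_1-D_0}{2}\theta_{N,n}$, $\Phi_n=\frac{\pi}{N}\sqrt{1-\theta_{N,n}^2}\,\phi_n$, $c_n=1+\phi_n^\alpha$. -/

import Mathlib

open MeasureTheory ProbabilityTheory Filter Topology

noncomputable section

namespace SGF

/-! ### Random network -/

/-- The plane in which the users are placed; the base station is at the origin. -/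
abbrev Plane : Type := EuclideanSpace ℝ (Fin 2)

/-- The disc of radius `DF` around the base station. -/
def disc (DF : ℝ) : Set Plane := Metric.closedBall 0 DF

/-- The ring with inner radius `D0` and outer radius `D1` around the base station. -/
def ring (D0 D1 : ℝ) : Set Plane := {x | D0 ≤ ‖x‖ ∧ ‖x‖ ≤ D1}

/-- The circularly symmetric complex Gaussian law `CN(0,1)`: independent real and imaginary parts,
each centred Gaussian of variance `1/2`. -/
def complexGaussian : Measure ℂ :=
  ((gaussianReal 0 (1 / 2)).prod (gaussianReal 0 (1 / 2))).map (fun p : ℝ × ℝ => (⟨p.1, p.2⟩ : ℂ))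

/-- Random locations and Rayleigh fading coefficients of the `K` grant-free (GF) users
(`X k`, `ζ k`) and of the grant-based (GB) user (`XB`, `ζB`): the GF users are uniform in the disc,
the GB user is uniform in the ring, the fading is `CN(0,1)`, and everything is independent. -/
structure IsNetwork {Ω : Type*} [MeasurableSpace Ω] (μ : Measure Ω) (K : ℕ) (DF D0 D1 : ℝ)
    (X : Fin K → Ω → Plane) (ζ : Fin K → Ω → ℂ) (XB : Ω → Plane) (ζB : Ω → ℂ) : Prop where
  law_X : ∀ k, HasLaw (X k) (cond volume (disc DF)) μ
  law_ζ : ∀ k, HasLaw (ζ k) complexGaussian μ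
  law_XB : HasLaw XB (cond volume (ring D0 D1)) μ
  law_ζB : HasLaw ζB complexGaussian μ
  indep_users : iIndepFun
    (fun (u : Option (Fin K)) (ω : Ω) => u.elim (XB ω, ζB ω) (fun k => (X k ω, ζ k ω))) μ
  indep_GF : ∀ k, IndepFun (X k) (ζ k) μ
  indep_GB : IndepFun XB ζB μ

/-- Channel coefficient `ζ / √(1 + r^α)` of a user at location `x`, where `r` is its distance to
the base station and `α` the path loss exponent. -/
def channel (α : ℝ) (x : Plane) (ζ : ℂ) : ℂ := ζ / (Real.sqrt (1 + ‖x‖ ^ α) : ℂ)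

/-! ### Transmission scheme -/

/-- Target SINR belonging to the target rate `R` (in bits). -/
def targetSINR (R : ℝ) : ℝ := 2 ^ R - 1

/-- Decoding threshold `τ₀ = max {0, P_B |g|² / γ_B - 1}` broadcast by the base station. -/
def threshold (PB γB : ℝ) (g : ℂ) : ℝ := max 0 (PB * ‖g‖ ^ 2 / γB - 1)

open Classical in
/-- Power control: transmit power of a GF user with channel `h`, when the GB channel is `g`. -/
def power (PB Pm γB : ℝ) (g h : ℂ) : ℝ :=
  if threshold PB γB g / Pm < ‖h‖ ^ 2 ∧
      ‖h‖ ^ 2 < threshold PB γB g * (1 + PB * ‖g‖ ^ 2) / Pm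
  then threshold PB γB g / ‖h‖ ^ 2 else Pm

open Classical in
/-- Achievable rate, under hybrid successive interference cancellation (SIC), of a GF user with
channel `h` that transmits with power `p`: its signal is decoded at the first stage of SIC if its
received power exceeds the threshold, and at the second stage otherwise. -/
def rate (PB γB : ℝ) (g h : ℂ) (p : ℝ) : ℝ :=
  if threshold PB γB g < p * ‖h‖ ^ 2
  then Real.logb 2 (1 + p * ‖h‖ ^ 2 / (PB * ‖g‖ ^ 2 + 1))
  else Real.logb 2 (1 + p * ‖h‖ ^ 2)

/-- Achievable rate of a GF user that uses the power control. -/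
def ratePC (PB Pm γB : ℝ) (g h : ℂ) : ℝ := rate PB γB g h (power PB Pm γB g h)

/-- The admission rule: at every outcome, the admitted GF user `U ω` is one with the largest
achievable rate (ties are broken arbitrarily). -/
def IsBestUser {Ω : Type*} {K : ℕ} (PB Pm γB : ℝ) (g : Ω → ℂ) (h : Fin K → Ω → ℂ)
    (U : Ω → Fin K) : Prop :=
  ∀ ω k, ratePC PB Pm γB (g ω) (h k ω) ≤ ratePC PB Pm γB (g ω) (h (U ω) ω)

/-- Outage probability of the admitted GF user: its achievable rate is below the target `RF`. -/
def outage {Ω : Type*} [MeasurableSpace Ω] (μ : Measure Ω) {K : ℕ} (PB Pm γB RF : ℝ)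
    (g : Ω → ℂ) (h : Fin K → Ω → ℂ) (U : Ω → Fin K) : ℝ :=
  μ.real {ω | ratePC PB Pm γB (g ω) (h (U ω) ω) < RF}

/-! ### Distribution functions of the channel gains -/

/-- CDF of the (unordered) channel gain of a GF user. -/
def cdfF (α DF x : ℝ) : ℝ :=
  2 / DF ^ 2 * ∫ r in (0 : ℝ)..DF, (1 - Real.exp (-(1 + r ^ α) * x)) * r

/-- CDF of the channel gain of the GB user. -/
def cdfB (α D0 D1 y : ℝ) : ℝ :=
  2 / (D1 ^ 2 - D0 ^ 2) * ∫ r in D0..D1, (1 - Real.exp (-(1 + r ^ α) * y)) * r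

/-- Density of the channel gain of the GB user (the derivative of `cdfB` in `y`). -/
def pdfB (α D0 D1 y : ℝ) : ℝ :=
  2 / (D1 ^ 2 - D0 ^ 2) * ∫ r in D0..D1, (1 + r ^ α) * Real.exp (-(1 + r ^ α) * y) * r

/-- The `i`-th Chebyshev node of order `n` (`1 ≤ i ≤ n`). -/
def node (n i : ℕ) : ℝ := Real.cos ((2 * (i : ℝ) - 1) / (2 * (n : ℝ)) * Real.pi)

/-- Gaussian-Chebyshev approximation of order `L` of `cdfF`. -/
def cdfFApprox (α DF : ℝ) (L : ℕ) (x : ℝ) : ℝ :=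
  1 / 2 * ∑ l ∈ Finset.Icc 1 L,
    (Real.pi / L * Real.sqrt (1 - node L l ^ 2) * (1 + node L l)) *
      (1 - Real.exp (-(1 + (DF / 2 + DF / 2 * node L l) ^ α) * x))

/-- The `n`-th distance used in the approximations of `cdfB` and `pdfB`. -/
def dist (D0 D1 : ℝ) (N n : ℕ) : ℝ := (D1 + D0) / 2 + (D1 - D0) / 2 * node N n

/-- Gaussian-Chebyshev approximation of order `N` of `cdfB`. -/
def cdfBApprox (α D0 D1 : ℝ) (N : ℕ) (y : ℝ) : ℝ :=
  1 / (D1 + D0) * ∑ n ∈ Finset.Icc 1 N,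
    (Real.pi / N * Real.sqrt (1 - node N n ^ 2) * dist D0 D1 N n) *
      (1 - Real.exp (-(1 + dist D0 D1 N n ^ α) * y))

/-- Gaussian-Chebyshev approximation of order `N` of `pdfB`. -/
def pdfBApprox (α D0 D1 : ℝ) (N : ℕ) (y : ℝ) : ℝ :=
  1 / (D1 + D0) * ∑ n ∈ Finset.Icc 1 N,
    (Real.pi / N * Real.sqrt (1 - node N n ^ 2) * dist D0 D1 N n) *
      (1 + dist D0 D1 N n ^ α) * Real.exp (-(1 + dist D0 D1 N n ^ α) * y)

/-! ### The terms of the outage formula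

`F` and `f` stand for the CDF of a GF gain and the density of the GB gain, exact or approximate;
`PF` is the power of the GF users. -/

/-- `α_B = γ_B / P_B`. -/
def αB (PB γB : ℝ) : ℝ := γB / PB

/-- `α_F = γ_F / P_F`. -/
def αF (PF γF : ℝ) : ℝ := γF / PF

/-- `α_1 = α_B (γ_F + 1)`. -/
def α1 (PB γB γF : ℝ) : ℝ := αB PB γB * (γF + 1)

/-- The integrand of the terms with index `1;k`. -/
def integrand1 (F f : ℝ → ℝ) (PB γB γF PF : ℝ) (K k : ℕ) (w : ℝ) : ℝ :=
  f w * F (((αB PB γB)⁻¹ * w - 1) / PF) ^ k *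
    (F (αF PF γF * PB * w + αF PF γF) - F (((αB PB γB)⁻¹ * w - 1) / PF)) ^ (K - k)

/-- The integrand of the terms with index `3`. -/
def integrand3 (F f : ℝ → ℝ) (PB γF PF : ℝ) (K : ℕ) (w : ℝ) : ℝ :=
  f w * F (αF PF γF * PB * w + αF PF γF) ^ K

/-- Gaussian-Chebyshev quadrature sum with `n` nodes for `∫_a^b φ`. -/
def quad (n : ℕ) (a b : ℝ) (φ : ℝ → ℝ) : ℝ :=
  (b - a) / 2 * ∑ i ∈ Finset.Icc 1 n,
    Real.pi / n * Real.sqrt (1 - node n i ^ 2) * φ (((b - a) * node n i + (b + a)) / 2)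

def I1 (F f : ℝ → ℝ) (PB γB γF PF : ℝ) (K k : ℕ) : ℝ :=
  ∫ w in (αB PB γB)..(α1 PB γB γF), integrand1 F f PB γB γF PF K k w

def I3 (F f : ℝ → ℝ) (PB γB γF PF : ℝ) (K : ℕ) : ℝ :=
  ∫ w in (0 : ℝ)..(αB PB γB), integrand3 F f PB γF PF K w

def G1 (F f : ℝ → ℝ) (PB γB γF PF : ℝ) (K k I : ℕ) : ℝ :=
  quad I (αB PB γB) (α1 PB γB γF) (integrand1 F f PB γB γF PF K k)

def G3 (F f : ℝ → ℝ) (PB γB γF PF : ℝ) (K M : ℕ) : ℝ :=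
  quad M 0 (αB PB γB) (integrand3 F f PB γF PF K)

def I5 (F FB : ℝ → ℝ) (PB Pm γB γF : ℝ) (K : ℕ) : ℝ :=
  (1 - FB (α1 PB γB γF)) * F (γF / Pm) ^ K

/-- The exact outage expression (integrals). -/
def exactFormula (F f FB : ℝ → ℝ) (PB Pm γB γF : ℝ) (K : ℕ) : ℝ :=
  ∑ k ∈ Finset.range (K + 1), (K.choose k : ℝ) * I1 F f PB γB γF Pm K k
    + I3 F f PB γB γF Pm K + I5 F FB PB Pm γB γF K

/-- The outage expression with quadrature sums of orders `I` and `M`. -/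
def quadFormula (F f FB : ℝ → ℝ) (PB Pm γB γF : ℝ) (K I M : ℕ) : ℝ :=
  ∑ k ∈ Finset.range (K + 1), (K.choose k : ℝ) * G1 F f PB γB γF Pm K k I
    + G3 F f PB γB γF Pm K M + I5 F FB PB Pm γB γF K

end SGF

end

noncomputable section

namespace SGF

/-! ### Gaussian-Chebyshev quadrature -/

/-! The admitted user has the largest rate, so there is an outage exactly when every GF user misses
the target. Power control makes this a one-sided condition on each gain: by `ratePC_lt_iff`, given
the GB gain `w`, a user misses the target iff its gain lies below `outageLevel`, which is `γF (1 +
PB w) / Pm` for `w < α1` and `γF / Pm` otherwise. The users are independent with common distribution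
function `F`, so the outage probability is the mean of `F (outageLevel W) ^ K` over the GB gain `W`
(`measure_forall_lt`, `outage_eq_integral`). The part `W ≥ α1` gives `I5`; the part `W < α1` is the
integral of `integrand3` over `(0, α1)`. On `(αB, α1)` the sum over `k` is only the binomial
expansion of that integrand (`sum_I1`), an algebraic identity, which is why no condition on `γB γF`
enters.

For the approximations, the substitution by `cos t` turns a Gaussian-Chebyshev sum into a midpoint
sum on `[0, π]`, which converges uniformly in a compact parameter. The approximate distribution
functions are such sums in the radius, hence converge locally uniformly. Quadrature is bounded in
the sup norm independently of the number of nodes (`abs_quad_le`), so the inner and outer limits can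
be taken jointly (`quadFormula_tendsto`). -/

theorem node_eq (n i : ℕ) : node n (i + 1) = Real.cos ((2 * i + 1) / (2 * n) * Real.pi) := by
  unfold node; congr 2; push_cast; ring

theorem angle_mem {n i : ℕ} (hi : i < n) :
    (2 * (i : ℝ) + 1) / (2 * n) * Real.pi ∈ Set.Icc 0 Real.pi := by
  have hn : (0 : ℝ) < n := by exact_mod_cast (Nat.zero_le i).trans_lt hi
  have hin : (i : ℝ) + 1 ≤ n := by exact_mod_cast hi
  refine ⟨by positivity, mul_le_of_le_one_left Real.pi_pos.le ?_⟩
  rw [div_le_one (by positivity)]; linarith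

/-- A quadrature sum is a midpoint sum in the angle `t`, where the node is `cos t`. -/
theorem quad_eq_midpoint (n : ℕ) (a b : ℝ) (φ : ℝ → ℝ) :
    quad n a b φ = ∑ i ∈ Finset.range n, Real.pi / n *
      ((b - a) / 2 * Real.sin ((2 * i + 1) / (2 * n) * Real.pi) *
        φ (((b - a) * Real.cos ((2 * i + 1) / (2 * n) * Real.pi) + (b + a)) / 2)) := by
  unfold quad
  rw [Finset.mul_sum, ← Finset.Ico_add_one_right_eq_Icc, Finset.sum_Ico_eq_sum_range]
  refine Finset.sum_congr (by simp) fun i hi => ?_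
  rw [Finset.mem_range] at hi
  -- The weight `√(1 - cos² t)` is `sin t`, because the angle lies in `[0, π]`.
  rw [add_comm 1 i, node_eq, ← Real.sin_sq, Real.sqrt_sq]
  · ring
  · exact Real.sin_nonneg_of_mem_Icc (angle_mem (by simpa using hi))

/-- The substitution by `cos t` reverses orientation; this sign cancels the one in the derivative
`-sin t`. -/
theorem integral_eq_integral_angle (a b : ℝ) {φ : ℝ → ℝ} (hφ : Continuous φ) :
    ∫ x in a..b, φ x = ∫ t in (0 : ℝ)..Real.pi, (b - a) / 2 * Real.sin t *
        φ (((b - a) * Real.cos t + (b + a)) / 2) := by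
  have h := intervalIntegral.integral_comp_mul_deriv (a := 0) (b := Real.pi)
    (f := fun t => ((b - a) * Real.cos t + (b + a)) / 2)
    (f' := fun t => (b - a) * (-Real.sin t) / 2) (g := φ)
    (fun t _ => (((Real.hasDerivAt_cos t).const_mul (b - a)).add_const (b + a)).div_const 2)
    (by fun_prop) hφ
  simp only [Function.comp_def, Real.cos_zero, Real.cos_pi] at h
  rw [intervalIntegral.integral_symm, show a = ((b - a) * (-1) + (b + a)) / 2 by ring,
    show ∫ x in b..((b - a) * (-1) + (b + a)) / 2, φ x =
      ∫ x in ((b - a) * 1 + (b + a)) / 2..((b - a) * (-1) + (b + a)) / 2, φ x by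
      congr 1; ring, ← h, ← intervalIntegral.integral_neg]
  refine intervalIntegral.integral_congr fun t _ => ?_
  ring_nf

/-- The midpoint rule on `[0, c]` converges uniformly in a compact parameter. -/
theorem midpoint_tendstoUniformlyOn {c : ℝ} (hc : 0 < c) {ψ : ℝ → ℝ → ℝ}
    (hψ : Continuous ψ.uncurry) {S : Set ℝ} (hS : IsCompact S) :
    TendstoUniformlyOn
      (fun (n : ℕ) x => ∑ i ∈ Finset.range n, c / n * ψ ((2 * i + 1) / (2 * n) * c) x)
      (fun x => ∫ t in (0 : ℝ)..c, ψ t x) atTop S := by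
  have hu : UniformContinuousOn ψ.uncurry (Set.Icc 0 c ×ˢ S) :=
    (isCompact_Icc.prod hS).uniformContinuousOn_of_continuous hψ.continuousOn
  rw [Metric.uniformContinuousOn_iff] at hu
  rw [Metric.tendstoUniformlyOn_iff]
  intro ε hε
  -- Each of the `n` cells of length `c / n` contributes at most `ε / (2c) * (c / n)`, so the total
  -- error is at most `ε / 2`.
  obtain ⟨δ, hδ, h⟩ := hu (ε / (2 * c)) (by positivity)
  obtain ⟨N, hN⟩ := exists_nat_gt (c / δ)
  filter_upwards [eventually_ge_atTop (N + 1)] with n hn x hx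
  have hn0 : (0 : ℝ) < n := by exact_mod_cast (Nat.succ_pos N).trans_le hn
  have hnδ : c / n < δ := by
    rw [div_lt_iff₀ hn0]
    rw [div_lt_iff₀ hδ] at hN
    have : (N : ℝ) ≤ n := by exact_mod_cast (Nat.le_succ N).trans hn
    nlinarith
  have hcont : Continuous fun t => ψ t x := hψ.comp (by fun_prop : Continuous fun t => (t, x))
  have hsplit : ∫ t in (0 : ℝ)..c, ψ t x =
      ∑ i ∈ Finset.range n, ∫ t in (i * (c / n) : ℝ)..((i + 1 : ℕ) * (c / n)), ψ t x := by
    rw [intervalIntegral.sum_integral_adjacent_intervals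
      (a := fun i : ℕ => (i * (c / n) : ℝ)) (fun i _ => hcont.intervalIntegrable _ _)]
    congr 1
    · simp
    · field_simp
  rw [hsplit, Real.dist_eq, ← Finset.sum_sub_distrib]
  refine (Finset.abs_sum_le_sum_abs _ _).trans_lt ?_
  calc _ ≤ ∑ i ∈ Finset.range n, ε / (2 * c) * (c / n) := by
        refine Finset.sum_le_sum fun i hi => ?_
        have hi : (i : ℝ) + 1 ≤ n := by exact_mod_cast Finset.mem_range.1 hi
        have hlen : ((i + 1 : ℕ) * (c / n) : ℝ) - i * (c / n) = c / n := by push_cast; ring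
        have hcn : 0 < c / n := by positivity
        have hmid : (2 * (i : ℝ) + 1) / (2 * n) * c = i * (c / n) + (c / n) / 2 := by
          field_simp
        have hend : ((i + 1 : ℕ) * (c / n) : ℝ) ≤ c := by
          push_cast
          calc ((i : ℝ) + 1) * (c / n) ≤ n * (c / n) := by gcongr
            _ = c := by field_simp
        have hstart : (0 : ℝ) ≤ i * (c / n) := by positivity
        have hconst : c / n * ψ ((2 * i + 1) / (2 * n) * c) x =
            ∫ t in (i * (c / n) : ℝ)..((i + 1 : ℕ) * (c / n)),
              ψ ((2 * i + 1) / (2 * n) * c) x := by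
          rw [intervalIntegral.integral_const, hlen, smul_eq_mul]
        rw [hconst, ← intervalIntegral.integral_sub (hcont.intervalIntegrable _ _)
          (by simp)]
        have := intervalIntegral.norm_integral_le_of_norm_le_const
          (a := (i * (c / n) : ℝ)) (b := (i + 1 : ℕ) * (c / n)) (C := ε / (2 * c))
          (f := fun t => ψ t x - ψ ((2 * i + 1) / (2 * n) * c) x) ?_
        · rwa [hlen, abs_of_pos hcn] at this
        · intro t ht
          rw [Set.uIoc_of_le (by linarith)] at ht
          obtain ⟨h1, h2⟩ := ht
          have := h (t, x) ⟨⟨by linarith, by linarith⟩, hx⟩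
            ((2 * i + 1) / (2 * n) * c, x) ⟨⟨by linarith, by linarith⟩, hx⟩ (by
              rw [Prod.dist_eq, dist_self, max_eq_left dist_nonneg, Real.dist_eq, hmid,
                abs_lt]
              constructor <;> linarith)
          rw [Real.dist_eq] at this
          exact this.le
    _ = ε / 2 := by
        rw [Finset.sum_const, Finset.card_range, nsmul_eq_mul]; field_simp
    _ < ε := by linarith

/-- Uniformity in the parameter matters because the approximate distribution functions are later
evaluated at nodes of an outer quadrature that move as its order grows. -/
theorem quad_tendstoUniformlyOn (a b : ℝ) {φ : ℝ → ℝ → ℝ} (hφ : Continuous φ.uncurry)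
    {S : Set ℝ} (hS : IsCompact S) :
    TendstoUniformlyOn (fun n x => quad n a b (fun r => φ r x))
      (fun x => ∫ r in a..b, φ r x) atTop S := by
  have hc : Continuous (Function.uncurry fun t x => (b - a) / 2 * Real.sin t *
      φ (((b - a) * Real.cos t + (b + a)) / 2) x) := by
    have := hφ.comp (by fun_prop : Continuous fun p : ℝ × ℝ =>
      (((b - a) * Real.cos p.1 + (b + a)) / 2, p.2))
    simp only [Function.comp_def, Function.uncurry_def] at this ⊢
    fun_prop
  have h := midpoint_tendstoUniformlyOn Real.pi_pos hc hS
  simp_rw [quad_eq_midpoint]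
  refine h.congr_right fun x _ => ?_
  exact (integral_eq_integral_angle a b
    (hφ.comp (by fun_prop : Continuous fun r => (r, x)))).symm

theorem quad_tendsto (a b : ℝ) {φ : ℝ → ℝ} (hφ : Continuous φ) :
    Tendsto (fun n => quad n a b φ) atTop (𝓝 (∫ r in a..b, φ r)) :=
  (quad_tendstoUniformlyOn a b (φ := fun r _ => φ r)
    (hφ.comp continuous_fst) (isCompact_singleton (x := (0 : ℝ)))).tendsto_at rfl

theorem quad_tendstoLocallyUniformly (a b : ℝ) {φ : ℝ → ℝ → ℝ} (hφ : Continuous φ.uncurry) :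
    TendstoLocallyUniformly (fun n x => quad n a b (fun r => φ r x))
      (fun x => ∫ r in a..b, φ r x) atTop := by
  rw [← tendstoLocallyUniformlyOn_univ,
    tendstoLocallyUniformlyOn_iff_forall_isCompact isOpen_univ]
  exact fun S _ hS => quad_tendstoUniformlyOn a b hφ hS

theorem quadArg_mem {a b : ℝ} (hab : a ≤ b) (n i : ℕ) :
    ((b - a) * node n i + (b + a)) / 2 ∈ Set.Icc a b := by
  have h1 := Real.neg_one_le_cos ((2 * (i : ℝ) - 1) / (2 * n) * Real.pi)
  have h2 := Real.cos_le_one ((2 * (i : ℝ) - 1) / (2 * n) * Real.pi)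
  change -1 ≤ node n i at h1
  change node n i ≤ 1 at h2
  constructor <;> nlinarith

theorem quad_sub (n : ℕ) (a b : ℝ) (φ ψ : ℝ → ℝ) :
    quad n a b (fun x => φ x - ψ x) = quad n a b φ - quad n a b ψ := by
  unfold quad
  rw [← mul_sub, ← Finset.sum_sub_distrib]
  congr 1
  exact Finset.sum_congr rfl fun i _ => by ring

/-- Each of the `n` weights is at most `π / n`, so they add up to at most `π`, whatever `n` is. -/
theorem abs_quad_le {a b C : ℝ} (hab : a ≤ b) {φ : ℝ → ℝ} (h : ∀ x ∈ Set.Icc a b, |φ x| ≤ C)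
    (n : ℕ) : |quad n a b φ| ≤ (b - a) / 2 * (Real.pi * C) := by
  have hC : 0 ≤ C := (abs_nonneg _).trans (h a ⟨le_rfl, hab⟩)
  unfold quad
  have hba : 0 ≤ (b - a) / 2 := by linarith
  rw [abs_mul, abs_of_nonneg hba]
  refine mul_le_mul_of_nonneg_left ?_ hba
  refine (Finset.abs_sum_le_sum_abs _ _).trans ?_
  calc _ ≤ ∑ i ∈ Finset.Icc 1 n, Real.pi / n * C := by
        refine Finset.sum_le_sum fun i _ => ?_
        have hp : 0 ≤ Real.pi / n := by positivity
        rw [abs_mul, abs_mul, abs_of_nonneg hp, abs_of_nonneg (Real.sqrt_nonneg _)]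
        gcongr ?_ * ?_
        · exact mul_le_of_le_one_right hp (Real.sqrt_le_one.2 (by nlinarith [sq_nonneg (node n i)]))
        · exact h _ (quadArg_mem hab n i)
    _ ≤ Real.pi * C := by
        rw [Finset.sum_const, nsmul_eq_mul, Nat.card_Icc, Nat.add_sub_cancel]
        rcases Nat.eq_zero_or_pos n with rfl | hn
        · simp; positivity
        · have : (0 : ℝ) < n := by exact_mod_cast hn
          field_simp; rfl

/-- Quadrature sums of functions that converge locally uniformly converge to the integral of the
limit. -/
theorem quad_tendsto_of_tendstoLocallyUniformly {ι : Type*} {l : Filter ι} {a b : ℝ} (hab : a ≤ b)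
    {φ : ι → ℝ → ℝ} {φ₀ : ℝ → ℝ} (hφ₀ : Continuous φ₀) (hφ : TendstoLocallyUniformly φ φ₀ l)
    {m : ι → ℕ} (hm : Tendsto m l atTop) :
    Tendsto (fun i => quad (m i) a b (φ i)) l (𝓝 (∫ x in a..b, φ₀ x)) := by
  have hu : TendstoUniformlyOn φ φ₀ l (Set.Icc a b) :=
    (tendstoLocallyUniformlyOn_iff_tendstoUniformlyOn_of_compact isCompact_Icc).1
      hφ.tendstoLocallyUniformlyOn
  have h0 : Tendsto (fun i => quad (m i) a b (φ i) - quad (m i) a b φ₀) l (𝓝 0) := by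
    rw [Metric.tendsto_nhds]
    intro ε hε
    rw [Metric.tendstoUniformlyOn_iff] at hu
    -- The summand `1` keeps the divisor of `ε` positive when `a = b`.
    have hpos : 0 < (b - a) / 2 * Real.pi + 1 := by
      have : 0 ≤ (b - a) / 2 * Real.pi := mul_nonneg (by linarith) Real.pi_pos.le
      linarith
    filter_upwards [hu (ε / ((b - a) / 2 * Real.pi + 1)) (by positivity)] with i hi
    rw [← quad_sub, Real.dist_0_eq_abs]
    refine (abs_quad_le hab (C := ε / ((b - a) / 2 * Real.pi + 1)) (fun x hx => ?_) _).trans_lt ?_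
    · have := (hi x hx).le
      rwa [dist_comm, Real.dist_eq] at this
    · rw [← mul_assoc, mul_div_assoc', div_lt_iff₀ hpos]
      nlinarith
  simpa using h0.add ((quad_tendsto a b hφ₀).comp hm)

/-! ### Convergence of the quadrature expressions -/

theorem continuous_cdfIntegrand {α : ℝ} (hα : 0 < α) :
    Continuous (Function.uncurry fun r x : ℝ => (1 - Real.exp (-(1 + r ^ α) * x)) * r) := by
  have := Real.continuous_rpow_const hα.le
  simp only [Function.uncurry_def]
  fun_prop

theorem continuous_pdfIntegrand {α : ℝ} (hα : 0 < α) :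
    Continuous (Function.uncurry
      fun r x : ℝ => (1 + r ^ α) * Real.exp (-(1 + r ^ α) * x) * r) := by
  have := Real.continuous_rpow_const hα.le
  simp only [Function.uncurry_def]
  fun_prop

theorem continuous_cdfB {α : ℝ} (hα : 0 < α) (D0 D1 : ℝ) : Continuous (cdfB α D0 D1) := by
  refine continuous_const.mul ?_
  exact intervalIntegral.continuous_parametric_intervalIntegral_of_continuous'
    (f := fun x r : ℝ => (1 - Real.exp (-(1 + r ^ α) * x)) * r)
    ((continuous_cdfIntegrand hα).comp continuous_swap) D0 D1

theorem continuous_pdfB {α : ℝ} (hα : 0 < α) (D0 D1 : ℝ) : Continuous (pdfB α D0 D1) := by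
  refine continuous_const.mul ?_
  exact intervalIntegral.continuous_parametric_intervalIntegral_of_continuous'
    (f := fun x r : ℝ => (1 + r ^ α) * Real.exp (-(1 + r ^ α) * x) * r)
    ((continuous_pdfIntegrand hα).comp continuous_swap) D0 D1

/-- The disc is the ring of inner radius `0`, so results on rings with `0 ≤ D0` serve both kinds of
user. -/
theorem cdfF_eq_cdfB (α DF : ℝ) : cdfF α DF = cdfB α 0 DF := by
  funext x; simp [cdfF, cdfB]

/-- The factor `1 + node L l` comes from the area element: at a node, `r = DF / 2 * (1 + node L l)`.
-/
theorem cdfFApprox_eq_quad (α : ℝ) {DF : ℝ} (hDF : DF ≠ 0) (L : ℕ) (x : ℝ) :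
    cdfFApprox α DF L x =
      2 / DF ^ 2 * quad L 0 DF fun r => (1 - Real.exp (-(1 + r ^ α) * x)) * r := by
  unfold cdfFApprox quad
  rw [← mul_assoc, Finset.mul_sum, Finset.mul_sum]
  refine Finset.sum_congr rfl fun l _ => ?_
  rw [show ((DF - 0) * node L l + (DF + 0)) / 2 = DF / 2 + DF / 2 * node L l by ring]
  field_simp
  ring

theorem cdfBApprox_eq_quad (α : ℝ) {D0 D1 : ℝ} (h : 0 < D0 + D1) (h' : D0 < D1) (N : ℕ) (x : ℝ) :
    cdfBApprox α D0 D1 N x =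
      2 / (D1 ^ 2 - D0 ^ 2) * quad N D0 D1 fun r => (1 - Real.exp (-(1 + r ^ α) * x)) * r := by
  have h1 : D1 + D0 ≠ 0 := by linarith
  have h2 : D1 - D0 ≠ 0 := by linarith
  unfold cdfBApprox quad
  rw [← mul_assoc, show 2 / (D1 ^ 2 - D0 ^ 2) * ((D1 - D0) / 2) = 1 / (D1 + D0) by
    rw [show D1 ^ 2 - D0 ^ 2 = (D1 + D0) * (D1 - D0) by ring]; field_simp]
  congr 1
  refine Finset.sum_congr rfl fun l _ => ?_
  rw [show ((D1 - D0) * node N l + (D1 + D0)) / 2 = dist D0 D1 N l by unfold dist; ring]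
  ring

theorem pdfBApprox_eq_quad (α : ℝ) {D0 D1 : ℝ} (h : 0 < D0 + D1) (h' : D0 < D1) (N : ℕ) (x : ℝ) :
    pdfBApprox α D0 D1 N x =
      2 / (D1 ^ 2 - D0 ^ 2) *
        quad N D0 D1 fun r => (1 + r ^ α) * Real.exp (-(1 + r ^ α) * x) * r := by
  have h1 : D1 + D0 ≠ 0 := by linarith
  have h2 : D1 - D0 ≠ 0 := by linarith
  unfold pdfBApprox quad
  rw [← mul_assoc, show 2 / (D1 ^ 2 - D0 ^ 2) * ((D1 - D0) / 2) = 1 / (D1 + D0) by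
    rw [show D1 ^ 2 - D0 ^ 2 = (D1 + D0) * (D1 - D0) by ring]; field_simp]
  congr 1
  refine Finset.sum_congr rfl fun l _ => ?_
  rw [show ((D1 - D0) * node N l + (D1 + D0)) / 2 = dist D0 D1 N l by unfold dist; ring]
  ring

/-- Read as convergence along `l ×ˢ 𝓝 x`, locally uniform convergence passes through products,
powers and continuous changes of argument by the ordinary rules for limits. -/
theorem tendstoLocallyUniformly_iff_tendsto_nhds {ι : Type*} {l : Filter ι}
    {f : ι → ℝ → ℝ} {f₀ : ℝ → ℝ} (hf₀ : Continuous f₀) :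
    TendstoLocallyUniformly f f₀ l ↔
      ∀ x, Tendsto (fun p : ι × ℝ => f p.1 p.2) (l ×ˢ 𝓝 x) (𝓝 (f₀ x)) := by
  rw [tendstoLocallyUniformly_iff_forall_tendsto]
  refine forall_congr' fun x => ?_
  have h0 : Tendsto (fun p : ι × ℝ => f₀ p.2) (l ×ˢ 𝓝 x) (𝓝 (f₀ x)) :=
    (hf₀.tendsto x).comp tendsto_snd
  rw [Metric.uniformity_eq_comap_nhds_zero, tendsto_comap_iff]
  simp only [Function.comp_def]
  constructor
  · intro h
    refine tendsto_of_tendsto_of_dist h0 h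
  · intro h
    simpa using h0.dist h

theorem quad_tendsto_prod_nhds (a b : ℝ) {φ : ℝ → ℝ → ℝ} (hφ : Continuous φ.uncurry) (x : ℝ) :
    Tendsto (fun p : ℕ × ℝ => quad p.1 a b fun r => φ r p.2) (atTop ×ˢ 𝓝 x)
      (𝓝 (∫ r in a..b, φ r x)) :=
  (tendstoLocallyUniformly_iff_tendsto_nhds
    (intervalIntegral.continuous_parametric_intervalIntegral_of_continuous'
      (f := fun x r => φ r x) (hφ.comp continuous_swap) _ _)).1
    (quad_tendstoLocallyUniformly a b hφ) x

theorem cdfFApprox_tendsto {α DF : ℝ} (hα : 0 < α) (hDF : 0 < DF) :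
    TendstoLocallyUniformly (cdfFApprox α DF) (cdfF α DF) atTop := by
  rw [tendstoLocallyUniformly_iff_tendsto_nhds
    (by rw [cdfF_eq_cdfB]; exact continuous_cdfB hα 0 DF)]
  intro x
  simp_rw [cdfFApprox_eq_quad α hDF.ne']
  exact (quad_tendsto_prod_nhds 0 DF (continuous_cdfIntegrand hα) x).const_mul _

theorem cdfBApprox_tendsto {α D0 D1 : ℝ} (hα : 0 < α) (hD0 : 0 < D0) (hD1 : D0 < D1) :
    TendstoLocallyUniformly (cdfBApprox α D0 D1) (cdfB α D0 D1) atTop := by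
  rw [tendstoLocallyUniformly_iff_tendsto_nhds (continuous_cdfB hα D0 D1)]
  intro x
  simp_rw [cdfBApprox_eq_quad α (by linarith : 0 < D0 + D1) hD1]
  exact (quad_tendsto_prod_nhds D0 D1 (continuous_cdfIntegrand hα) x).const_mul _

theorem pdfBApprox_tendsto {α D0 D1 : ℝ} (hα : 0 < α) (hD0 : 0 < D0) (hD1 : D0 < D1) :
    TendstoLocallyUniformly (pdfBApprox α D0 D1) (pdfB α D0 D1) atTop := by
  rw [tendstoLocallyUniformly_iff_tendsto_nhds (continuous_pdfB hα D0 D1)]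
  intro x
  simp_rw [pdfBApprox_eq_quad α (by linarith : 0 < D0 + D1) hD1]
  exact (quad_tendsto_prod_nhds D0 D1 (continuous_pdfIntegrand hα) x).const_mul _

/-- Binomial theorem for `A + (B - A) = B`; the sign of `B - A` plays no role. -/
theorem integrand1_eq_integrand3_sum (F f : ℝ → ℝ) (PB γB γF PF : ℝ) (K : ℕ) (w : ℝ) :
    ∑ k ∈ Finset.range (K + 1), (K.choose k : ℝ) * integrand1 F f PB γB γF PF K k w =
      integrand3 F f PB γF PF K w := by
  have h := add_pow (F (((αB PB γB)⁻¹ * w - 1) / PF))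
    (F (αF PF γF * PB * w + αF PF γF) - F (((αB PB γB)⁻¹ * w - 1) / PF)) K
  rw [add_sub_cancel] at h
  unfold integrand1 integrand3
  rw [h, Finset.mul_sum]
  exact Finset.sum_congr rfl fun k _ => by ring

theorem continuous_integrand1 {F f : ℝ → ℝ} (hF : Continuous F) (hf : Continuous f)
    (PB γB γF PF : ℝ) (K k : ℕ) : Continuous (integrand1 F f PB γB γF PF K k) := by
  unfold integrand1
  fun_prop

theorem continuous_integrand3 {F f : ℝ → ℝ} (hF : Continuous F) (hf : Continuous f)
    (PB γF PF : ℝ) (K : ℕ) : Continuous (integrand3 F f PB γF PF K) := by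
  unfold integrand3
  fun_prop

/-- The quadrature expression converges to the exact one when the distribution functions converge
locally uniformly and the numbers of nodes tend to infinity. -/
theorem quadFormula_tendsto {ι : Type*} {l : Filter ι} {F f FB : ι → ℝ → ℝ} {F₀ f₀ FB₀ : ℝ → ℝ}
    (hF₀ : Continuous F₀) (hf₀ : Continuous f₀)
    (hF : TendstoLocallyUniformly F F₀ l) (hf : TendstoLocallyUniformly f f₀ l)
    (hFB : TendstoLocallyUniformly FB FB₀ l) {PB Pm γB γF : ℝ} (hαB : 0 ≤ αB PB γB) (hγF : 0 ≤ γF)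
    (K : ℕ) {I M : ι → ℕ} (hI : Tendsto I l atTop) (hM : Tendsto M l atTop) :
    Tendsto (fun i => quadFormula (F i) (f i) (FB i) PB Pm γB γF K (I i) (M i)) l
      (𝓝 (exactFormula F₀ f₀ FB₀ PB Pm γB γF K)) := by
  have hF' := (tendstoLocallyUniformly_iff_tendsto_nhds hF₀).1 hF
  have hf' := (tendstoLocallyUniformly_iff_tendsto_nhds hf₀).1 hf
  have hcomp : ∀ (u : ℝ → ℝ), Continuous u → ∀ x,
      Tendsto (fun p : ι × ℝ => F p.1 (u p.2)) (l ×ˢ 𝓝 x) (𝓝 (F₀ (u x))) := fun u hu x =>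
    (hF' (u x)).comp (tendsto_fst.prodMk ((hu.tendsto x).comp tendsto_snd))
  have h3 : TendstoLocallyUniformly (fun i => integrand3 (F i) (f i) PB γF Pm K)
      (integrand3 F₀ f₀ PB γF Pm K) l := by
    rw [tendstoLocallyUniformly_iff_tendsto_nhds (continuous_integrand3 hF₀ hf₀ _ _ _ _)]
    exact fun x => (hf' x).mul
      ((hcomp (fun w => αF Pm γF * PB * w + αF Pm γF) (by fun_prop) x).pow K)
  have h1 : ∀ k, TendstoLocallyUniformly (fun i => integrand1 (F i) (f i) PB γB γF Pm K k)
      (integrand1 F₀ f₀ PB γB γF Pm K k) l := by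
    intro k
    rw [tendstoLocallyUniformly_iff_tendsto_nhds (continuous_integrand1 hF₀ hf₀ _ _ _ _ _ _)]
    intro x
    have hx := hcomp (fun w => ((αB PB γB)⁻¹ * w - 1) / Pm) (by fun_prop) x
    exact ((hf' x).mul (hx.pow k)).mul
      (((hcomp (fun w => αF Pm γF * PB * w + αF Pm γF) (by fun_prop) x).sub hx).pow (K - k))
  have hpt : ∀ {G : ι → ℝ → ℝ} {G₀ : ℝ → ℝ}, TendstoLocallyUniformly G G₀ l → ∀ x,
      Tendsto (fun i => G i x) l (𝓝 (G₀ x)) := fun hG x =>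
    (tendstoLocallyUniformlyOn_univ.2 hG).tendsto_at (Set.mem_univ x)
  refine ((tendsto_finsetSum _ fun k _ => ?_).add ?_).add ?_
  · exact (quad_tendsto_of_tendstoLocallyUniformly (by unfold α1; nlinarith)
      (continuous_integrand1 hF₀ hf₀ _ _ _ _ _ _) (h1 k) hI).const_mul _
  · exact quad_tendsto_of_tendstoLocallyUniformly hαB
      (continuous_integrand3 hF₀ hf₀ _ _ _ _) h3 hM
  · exact ((hpt hFB _).const_sub 1).mul ((hpt hF _).pow K)

/-! ### Distribution of the channel gains -/

/-- Integral of a radial function over a ring in a two-dimensional space. -/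
theorem setIntegral_fun_norm {E : Type*} [NormedAddCommGroup E] [NormedSpace ℝ E]
    [MeasurableSpace E] [BorelSpace E] [FiniteDimensional ℝ E] [Nontrivial E]
    (hE : Module.finrank ℝ E = 2) (m : Measure E) [m.IsAddHaarMeasure] {a b : ℝ} (ha : 0 ≤ a)
    (hab : a ≤ b) (f : ℝ → ℝ) :
    ∫ x in {x : E | a ≤ ‖x‖ ∧ ‖x‖ ≤ b}, f ‖x‖ ∂m =
      2 * m.real (Metric.ball 0 1) * ∫ r in a..b, f r * r := by
  have hms : MeasurableSet {x : E | a ≤ ‖x‖ ∧ ‖x‖ ≤ b} :=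
    (measurableSet_Icc (a := a) (b := b)).preimage measurable_norm
  have hind : ∀ x : E, {x : E | a ≤ ‖x‖ ∧ ‖x‖ ≤ b}.indicator (fun x => f ‖x‖) x =
      (Set.Icc a b).indicator f ‖x‖ := fun x => by
    simp [Set.indicator_apply]
  rw [← integral_indicator hms, integral_congr_ae (Eventually.of_forall hind),
    integral_fun_norm_addHaar m ((Set.Icc a b).indicator f), hE, nsmul_eq_mul, smul_eq_mul,
    ← mul_assoc]
  congr 1
  have h1 : ∀ y : ℝ, y ^ (2 - 1) • (Set.Icc a b).indicator f y =
      (Set.Icc a b).indicator (fun y => f y * y) y := fun y => by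
    by_cases hy : y ∈ Set.Icc a b <;> simp [hy, mul_comm]
  simp_rw [h1]
  rw [setIntegral_indicator measurableSet_Icc, intervalIntegral.integral_of_le hab]
  refine setIntegral_congr_set ?_
  -- The half-open interval omits its left endpoint, so it lies in `Ioi 0` even if `a = 0`.
  have h2 : Set.Ioc a b = Set.Ioi 0 ∩ Set.Ioc a b := by
    rw [eq_comm, Set.inter_eq_right]
    exact fun x hx => ha.trans_lt hx.1
  rw [h2]
  exact (ae_eq_refl _).inter Ioc_ae_eq_Icc.symm

theorem complexGaussian_eq_withDensity :
    complexGaussian =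
      volume.withDensity fun z : ℂ => ENNReal.ofReal (Real.pi⁻¹ * Real.exp (-‖z‖ ^ 2)) := by
  have hmp := Complex.volume_preserving_equiv_real_prod.symm
  have hf : Measurable fun z : ℂ => ENNReal.ofReal (Real.pi⁻¹ * Real.exp (-‖z‖ ^ 2)) := by
    fun_prop
  have hpt : ∀ p : ℝ × ℝ, gaussianPDF 0 (1 / 2) p.1 * gaussianPDF 0 (1 / 2) p.2 =
      ENNReal.ofReal
        (Real.pi⁻¹ * Real.exp (-‖Complex.measurableEquivRealProd.symm p‖ ^ 2)) := by
    intro p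
    -- With variance `1/2`, each Gaussian density is normalised by `1 / √π`.
    have hs : (√(2 * Real.pi * ((1 / 2 : NNReal) : ℝ)))⁻¹ *
        (√(2 * Real.pi * ((1 / 2 : NNReal) : ℝ)))⁻¹ = Real.pi⁻¹ := by
      rw [← mul_inv, Real.mul_self_sqrt (by positivity)]
      congr 1
      push_cast; ring
    rw [gaussianPDF, gaussianPDF, ← ENNReal.ofReal_mul (gaussianPDFReal_nonneg _ _ _),
      gaussianPDFReal, gaussianPDFReal, mul_mul_mul_comm, hs, ← Real.exp_add,
      Complex.measurableEquivRealProd_symm_apply, Complex.sq_norm, Complex.normSq_mk]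
    congr 3
    push_cast; ring
  have hg : Measurable (gaussianPDF 0 (1 / 2)) := measurable_gaussianPDF _ _
  rw [complexGaussian, gaussianReal_of_var_ne_zero _ (by norm_num), prod_withDensity hg hg]
  change Measure.map Complex.measurableEquivRealProd.symm _ = _
  ext s hs
  rw [Measure.map_apply hmp.measurable hs, withDensity_apply _ (hmp.measurable hs),
    withDensity_apply _ hs, ← hmp.setLIntegral_comp_preimage hs hf]
  simp_rw [hpt]
  rfl

instance : IsProbabilityMeasure complexGaussian := by
  unfold complexGaussian
  exact Measure.isProbabilityMeasure_map
    Complex.measurableEquivRealProd.symm.measurable.aemeasurable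

/-- The density is radial, so polar coordinates reduce the claim to the elementary integral of `r *
exp (-r²)`: the squared modulus is exponential with mean `1`. -/
theorem complexGaussian_sq_le {t : ℝ} (ht : 0 ≤ t) :
    complexGaussian {z | ‖z‖ ^ 2 ≤ t} = ENNReal.ofReal (1 - Real.exp (-t)) := by
  have hset : {z : ℂ | ‖z‖ ^ 2 ≤ t} = {z : ℂ | 0 ≤ ‖z‖ ∧ ‖z‖ ≤ √t} := by
    ext z
    simp [Real.le_sqrt (norm_nonneg z) ht]
  have hms : MeasurableSet {z : ℂ | 0 ≤ ‖z‖ ∧ ‖z‖ ≤ √t} :=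
    (measurableSet_Icc (a := 0) (b := √t)).preimage measurable_norm
  have hder : ∀ r : ℝ, HasDerivAt (fun r => -(Real.pi⁻¹ * Real.exp (-r ^ 2) / 2))
      (Real.pi⁻¹ * Real.exp (-r ^ 2) * r) r := fun r => by
    have := ((((hasDerivAt_pow 2 r).neg.exp).const_mul Real.pi⁻¹).div_const 2).neg
    refine HasDerivAt.congr_deriv this ?_
    simp
    ring
  have hint : IntegrableOn (fun z : ℂ => Real.pi⁻¹ * Real.exp (-‖z‖ ^ 2))
      {z : ℂ | 0 ≤ ‖z‖ ∧ ‖z‖ ≤ √t} := by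
    have hc : {z : ℂ | 0 ≤ ‖z‖ ∧ ‖z‖ ≤ √t} = Metric.closedBall 0 √t := by
      ext z; simp
    rw [hc]
    exact (by fun_prop : Continuous fun z : ℂ => Real.pi⁻¹ * Real.exp (-‖z‖ ^ 2)).continuousOn
      |>.integrableOn_compact (isCompact_closedBall _ _)
  rw [complexGaussian_eq_withDensity, hset, withDensity_apply _ hms,
    ← ofReal_integral_eq_lintegral_ofReal hint
      (Eventually.of_forall fun z => by positivity),
    setIntegral_fun_norm Complex.finrank_real_complex volume le_rfl (Real.sqrt_nonneg t)
      (fun r => Real.pi⁻¹ * Real.exp (-r ^ 2)),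
    intervalIntegral.integral_eq_sub_of_hasDerivAt (fun r _ => hder r)
      ((by fun_prop : Continuous _).intervalIntegrable _ _), measureReal_def,
    Complex.volume_ball, Real.sq_sqrt ht]
  congr 1
  have := Real.pi_pos.ne'
  simp
  field_simp
  ring

/-- Channel gain of a user at location `p.1` with fading coefficient `p.2`. -/
def gain (α : ℝ) (p : Plane × ℂ) : ℝ := ‖channel α p.1 p.2‖ ^ 2

theorem gain_eq (α : ℝ) (p : Plane × ℂ) : gain α p = ‖p.2‖ ^ 2 / (1 + ‖p.1‖ ^ α) := by
  have : 0 ≤ 1 + ‖p.1‖ ^ α := by positivity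
  rw [gain, channel, norm_div, div_pow, Complex.norm_real, Real.norm_eq_abs, sq_abs,
    Real.sq_sqrt this]

theorem measurable_gain (α : ℝ) : Measurable (gain α) := by
  have : gain α = fun p => ‖p.2‖ ^ 2 / (1 + ‖p.1‖ ^ α) := funext (gain_eq α)
  rw [this]
  fun_prop

theorem disc_eq_ring (DF : ℝ) : disc DF = ring 0 DF := by
  ext x; simp [disc, ring]

theorem isCompact_ring (D0 D1 : ℝ) : IsCompact (ring D0 D1) := by
  refine (isCompact_closedBall (0 : Plane) D1).of_isClosed_subset ?_ fun x hx => by simpa using hx.2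
  exact (isClosed_Icc (a := D0) (b := D1)).preimage continuous_norm

theorem volume_real_ring {D0 D1 : ℝ} (hD0 : 0 ≤ D0) (hD1 : D0 ≤ D1) :
    (volume : Measure Plane).real (ring D0 D1) =
      (volume : Measure Plane).real (Metric.ball 0 1) * (D1 ^ 2 - D0 ^ 2) := by
  have h := setIntegral_fun_norm (E := Plane) (by simp) volume hD0 hD1 fun _ => 1
  simp only [integral_const, smul_eq_mul, mul_one, one_mul, integral_id,
    measureReal_restrict_apply_univ] at h
  rw [ring, h]; ring_nf

theorem volume_real_ball_pos : 0 < (volume : Measure Plane).real (Metric.ball 0 1) :=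
  ENNReal.toReal_pos (Metric.measure_ball_pos _ _ one_pos).ne' measure_ball_lt_top.ne

theorem volume_ring_ne_zero {D0 D1 : ℝ} (hD0 : 0 ≤ D0) (hD1 : D0 < D1) :
    (volume : Measure Plane) (ring D0 D1) ≠ 0 := by
  intro h
  have h1 := volume_real_ring hD0 hD1.le
  rw [measureReal_def, h] at h1
  have : 0 < D1 ^ 2 - D0 ^ 2 := by nlinarith
  exact (mul_pos volume_real_ball_pos this).ne h1

theorem isProbabilityMeasure_cond_ring {D0 D1 : ℝ} (hD0 : 0 ≤ D0) (hD1 : D0 < D1) :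
    IsProbabilityMeasure (cond (volume : Measure Plane) (ring D0 D1)) :=
  cond_isProbabilityMeasure_of_finite (volume_ring_ne_zero hD0 hD1)
    (isCompact_ring D0 D1).measure_ne_top

/-- The volume of the unit ball occurs both in the radial integral and in the normalisation, and
cancels. -/
theorem integral_cond_ring {D0 D1 : ℝ} (hD0 : 0 ≤ D0) (hD1 : D0 < D1) (f : ℝ → ℝ) :
    ∫ x, f ‖x‖ ∂(cond (volume : Measure Plane) (ring D0 D1)) =
      2 / (D1 ^ 2 - D0 ^ 2) * ∫ r in D0..D1, f r * r := by
  have h1 : D1 ^ 2 - D0 ^ 2 ≠ 0 := by nlinarith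
  have h2 := volume_real_ball_pos.ne'
  have h := setIntegral_fun_norm (E := Plane) (by simp) volume hD0 hD1.le f
  rw [ProbabilityTheory.cond, integral_smul_measure, ENNReal.toReal_inv, ← measureReal_def,
    volume_real_ring hD0 hD1.le, smul_eq_mul]
  change _ * ∫ x in {x : Plane | D0 ≤ ‖x‖ ∧ ‖x‖ ≤ D1}, f ‖x‖ = _
  rw [h]
  field_simp

/-- Distribution function of the gain of a user that is uniform in a ring. -/
theorem gain_le {α D0 D1 : ℝ} (hα : 0 < α) (hD0 : 0 ≤ D0) (hD1 : D0 < D1) {y : ℝ} (hy : 0 ≤ y) :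
    ((cond volume (ring D0 D1)).prod complexGaussian) {p | gain α p ≤ y} =
      ENNReal.ofReal (cdfB α D0 D1 y) := by
  have := isProbabilityMeasure_cond_ring hD0 hD1
  have hset : ∀ x : Plane, Prod.mk x ⁻¹' {p : Plane × ℂ | gain α p ≤ y} =
      {z : ℂ | ‖z‖ ^ 2 ≤ (1 + ‖x‖ ^ α) * y} := fun x => by
    ext z
    have : 0 < 1 + ‖x‖ ^ α := by positivity
    simp only [Set.mem_preimage, Set.mem_ofPred_eq, gain_eq]
    rw [div_le_iff₀ this, mul_comm]
  have hnn : ∀ x : Plane, 0 ≤ 1 - Real.exp (-((1 + ‖x‖ ^ α) * y)) := fun x => by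
    have : 0 ≤ (1 + ‖x‖ ^ α) * y := by positivity
    simpa
  have hcont : Continuous fun x : Plane => 1 - Real.exp (-((1 + ‖x‖ ^ α) * y)) := by
    have := (Real.continuous_rpow_const hα.le).comp (continuous_norm (E := Plane))
    simp only [Function.comp_def] at this
    fun_prop
  rw [Measure.prod_apply (measurableSet_le (measurable_gain α) measurable_const)]
  simp_rw [hset]
  rw [lintegral_congr fun x => complexGaussian_sq_le (by positivity),
    ← ofReal_integral_eq_lintegral_ofReal _ (Eventually.of_forall hnn),
    integral_cond_ring hD0 hD1 fun r => 1 - Real.exp (-((1 + r ^ α) * y))]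
  · simp only [cdfB, neg_mul]
  · refine Integrable.of_bound hcont.aestronglyMeasurable 1 (Eventually.of_forall fun x => ?_)
    rw [Real.norm_of_nonneg (hnn x)]
    have := Real.exp_pos (-((1 + ‖x‖ ^ α) * y))
    linarith

theorem pdfB_nonneg {α D0 D1 : ℝ} (hD0 : 0 ≤ D0) (hD1 : D0 < D1) (w : ℝ) :
    0 ≤ pdfB α D0 D1 w := by
  refine mul_nonneg (div_nonneg (by norm_num) (by nlinarith)) ?_
  refine intervalIntegral.integral_nonneg hD1.le fun r hr => ?_
  have := hD0.trans hr.1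
  positivity

/-- Fubini leaves an elementary integral in `w`. This integrated form of `F' = f` avoids
differentiating under the integral sign. -/
theorem integral_pdfB {α : ℝ} (hα : 0 < α) (D0 D1 y : ℝ) :
    ∫ w in (0 : ℝ)..y, pdfB α D0 D1 w = cdfB α D0 D1 y := by
  unfold pdfB cdfB
  rw [intervalIntegral.integral_const_mul, intervalIntegral_intervalIntegral_swap
    (F := fun w r => (1 + r ^ α) * Real.exp (-(1 + r ^ α) * w) * r)]
  · congr 1
    refine intervalIntegral.integral_congr fun r _ => ?_
    have hder : ∀ w : ℝ, HasDerivAt (fun w => -Real.exp (-(1 + r ^ α) * w) * r)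
        ((1 + r ^ α) * Real.exp (-(1 + r ^ α) * w) * r) w := fun w => by
      have := (((hasDerivAt_id w).const_mul (-(1 + r ^ α))).exp.neg).mul_const r
      refine HasDerivAt.congr_deriv this ?_
      simp
      ring
    rw [intervalIntegral.integral_eq_sub_of_hasDerivAt (fun w _ => hder w)
      ((by fun_prop : Continuous _).intervalIntegrable _ _)]
    simp; ring
  · refine IntegrableOn.mono_set (t := Set.uIcc 0 y ×ˢ Set.uIcc D0 D1) ?_
      (Set.prod_mono Set.uIoc_subset_uIcc Set.uIoc_subset_uIcc)
    exact ((continuous_pdfIntegrand hα).comp continuous_swap).continuousOn.integrableOn_compact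
      (isCompact_uIcc.prod isCompact_uIcc)

/-- Law of the gain of a user that is uniform in the ring with radii `D0` and `D1`. -/
def gainLaw (α D0 D1 : ℝ) : Measure ℝ :=
  (volume.restrict (Set.Ioi 0)).withDensity fun w => ENNReal.ofReal (pdfB α D0 D1 w)

theorem gainLaw_Iic {α D0 D1 : ℝ} (hα : 0 < α) (hD0 : 0 ≤ D0) (hD1 : D0 < D1) {y : ℝ}
    (hy : 0 ≤ y) : gainLaw α D0 D1 (Set.Iic y) = ENNReal.ofReal (cdfB α D0 D1 y) := by
  rw [gainLaw, withDensity_apply _ measurableSet_Iic, Measure.restrict_restrict measurableSet_Iic,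
    Set.inter_comm, Set.Ioi_inter_Iic, ← integral_pdfB hα, intervalIntegral.integral_of_le hy,
    ← ofReal_integral_eq_lintegral_ofReal _ (Eventually.of_forall (pdfB_nonneg hD0 hD1))]
  exact (continuous_pdfB hα D0 D1).integrableOn_Ioc

theorem gainLaw_Iic_of_neg (α D0 D1 : ℝ) {y : ℝ} (hy : y < 0) :
    gainLaw α D0 D1 (Set.Iic y) = 0 := by
  rw [gainLaw, withDensity_apply _ measurableSet_Iic, Measure.restrict_restrict measurableSet_Iic,
    Set.inter_comm, Set.Ioi_inter_Iic, Set.Ioc_eq_empty (by linarith)]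
  simp

/-- The law has a density, hence no atoms. The strict form is needed because outage is a strict
inequality. -/
theorem gainLaw_Iio {α D0 D1 : ℝ} (hα : 0 < α) (hD0 : 0 ≤ D0) (hD1 : D0 < D1) {y : ℝ}
    (hy : 0 ≤ y) : gainLaw α D0 D1 (Set.Iio y) = ENNReal.ofReal (cdfB α D0 D1 y) := by
  rw [← gainLaw_Iic hα hD0 hD1 hy]
  have hac : gainLaw α D0 D1 ≪ volume :=
    (withDensity_absolutelyContinuous _ _).trans Measure.restrict_le_self.absolutelyContinuous
  exact measure_congr (hac.ae_eq Iio_ae_eq_Iic)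

theorem map_gain {α D0 D1 : ℝ} (hα : 0 < α) (hD0 : 0 ≤ D0) (hD1 : D0 < D1) :
    ((cond volume (ring D0 D1)).prod complexGaussian).map (gain α) = gainLaw α D0 D1 := by
  have := isProbabilityMeasure_cond_ring hD0 hD1
  refine Measure.ext_of_Iic _ _ fun y => ?_
  rw [Measure.map_apply (measurable_gain α) measurableSet_Iic]
  rcases lt_or_ge y 0 with hy | hy
  · rw [gainLaw_Iic_of_neg α D0 D1 hy]
    have hempty : gain α ⁻¹' Set.Iic y = ∅ :=
      Set.eq_empty_of_forall_notMem fun p hp => (hy.trans_le (sq_nonneg _)).not_ge hp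
    rw [hempty, measure_empty]
  · rw [gainLaw_Iic hα hD0 hD1 hy]
    exact gain_le hα hD0 hD1 hy

theorem isProbabilityMeasure_gainLaw {α D0 D1 : ℝ} (hα : 0 < α) (hD0 : 0 ≤ D0) (hD1 : D0 < D1) :
    IsProbabilityMeasure (gainLaw α D0 D1) := by
  have := isProbabilityMeasure_cond_ring hD0 hD1
  rw [← map_gain hα hD0 hD1]
  exact Measure.isProbabilityMeasure_map (measurable_gain α).aemeasurable

theorem hasLaw_gain {Ω : Type*} [MeasurableSpace Ω] {μ : Measure Ω} [IsProbabilityMeasure μ]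
    {α D0 D1 : ℝ} (hα : 0 < α) (hD0 : 0 ≤ D0) (hD1 : D0 < D1) {X : Ω → Plane} {ζ : Ω → ℂ}
    (hX : HasLaw X (cond volume (ring D0 D1)) μ) (hζ : HasLaw ζ complexGaussian μ)
    (h : IndepFun X ζ μ) : HasLaw (fun ω => gain α (X ω, ζ ω)) (gainLaw α D0 D1) μ where
  aemeasurable := (measurable_gain α).comp_aemeasurable (hX.aemeasurable.prodMk hζ.aemeasurable)
  map_eq := by
    rw [← map_gain hα hD0 hD1, ← hX.map_eq, ← hζ.map_eq,
      ← (indepFun_iff_map_prod_eq_prod_map_map hX.aemeasurable hζ.aemeasurable).1 h,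
      AEMeasurable.map_map_of_aemeasurable (measurable_gain α).aemeasurable
        (hX.aemeasurable.prodMk hζ.aemeasurable)]
    rfl

/-! ### The outage event -/

theorem targetSINR_pos {R : ℝ} (hR : 0 < R) : 0 < targetSINR R := by
  have := Real.one_lt_rpow (x := 2) (by norm_num) hR
  unfold targetSINR; linarith

theorem logb_one_add_lt_iff {s R : ℝ} (hs : 0 ≤ s) :
    Real.logb 2 (1 + s) < R ↔ s < targetSINR R := by
  rw [Real.logb_lt_iff_lt_rpow (by norm_num) (by linarith), targetSINR, lt_sub_iff_add_lt']

/-- Level of the GF gain below which a GF user is in outage, as a function of the GB gain `w`. -/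
def outageLevel (PB Pm γB γF w : ℝ) : ℝ :=
  if w < α1 PB γB γF then αF Pm γF * PB * w + αF Pm γF else γF / Pm

theorem measurable_outageLevel (PB Pm γB γF : ℝ) : Measurable (outageLevel PB Pm γB γF) :=
  Measurable.ite measurableSet_Iio (by fun_prop) measurable_const

/-- Write `s = Pm x` for the received power at full power. Inside the power-control window the
received power is exactly `τ`, and the rate is `log₂ (1 + τ)`. Outside it, either `s ≤ τ`, with SINR
`s`, or `s ≥ τ (1 + PB w)`, with SINR `s / (1 + PB w)`. The window removes the range where
first-stage decoding would lower the rate, so a single level decides each case, depending only on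
whether `τ < γF`. -/
theorem ratePC_lt_iff {PB Pm γB RF : ℝ} (hPB : 0 < PB) (hPm : 0 < Pm) (hγB : 0 < γB)
    (hRF : 0 < RF) (g h : ℂ) :
    ratePC PB Pm γB g h < RF ↔ ‖h‖ ^ 2 < outageLevel PB Pm γB (targetSINR RF) (‖g‖ ^ 2) := by
  have hγF := targetSINR_pos hRF
  set γF := targetSINR RF with hγF_def
  unfold ratePC rate power outageLevel
  set τ := threshold PB γB g with hτ_def
  have hτ : 0 ≤ τ := le_max_left _ _
  -- Since `γF > 0`, the truncation of `τ` at `0` does not affect the comparison.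
  have hlevel : ‖g‖ ^ 2 < α1 PB γB γF ↔ τ < γF := by
    rw [hτ_def, threshold, max_lt_iff, α1, αB, sub_lt_iff_lt_add, div_lt_iff₀ hγB,
      div_mul_eq_mul_div, lt_div_iff₀ hPB]
    constructor
    · intro h; exact ⟨hγF, by linarith⟩
    · rintro ⟨_, h⟩; linarith
  have hw : 0 ≤ ‖g‖ ^ 2 := sq_nonneg _
  have hx : 0 ≤ ‖h‖ ^ 2 := sq_nonneg _
  rw [if_congr hlevel rfl rfl]
  clear_value τ
  generalize ‖g‖ ^ 2 = w at hw ⊢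
  generalize ‖h‖ ^ 2 = x at hx ⊢
  have hPw : 0 ≤ PB * w := by positivity
  have hlin : αF Pm γF * PB * w + αF Pm γF = γF * (1 + PB * w) / Pm := by
    unfold αF; field_simp; ring
  rw [hlin]
  by_cases hc : τ / Pm < x ∧ x < τ * (1 + PB * w) / Pm
  · have hx0 : 0 < x := (div_nonneg hτ hPm.le).trans_lt hc.1
    rw [if_pos hc, div_mul_cancel₀ _ hx0.ne', if_neg (lt_irrefl _), logb_one_add_lt_iff hτ]
    split_ifs with hlt
    · refine ⟨fun _ => hc.2.trans_le ?_, fun _ => hlt⟩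
      gcongr
    -- Here `γF ≤ τ`, so the window gives `γF / Pm ≤ τ / Pm < x` and both sides fail.
    · refine ⟨fun h => absurd h hlt, fun h => absurd (h.trans_le ?_) hc.1.not_gt⟩
      gcongr
      exact not_lt.1 hlt
  · rw [if_neg hc]
    rw [not_and_or, not_lt, not_lt, le_div_iff₀ hPm, div_le_iff₀ hPm, mul_comm x] at hc
    rw [← ite_div, lt_div_iff₀ hPm, mul_comm x]
    generalize hs : Pm * x = s at hc ⊢
    have hs0 : 0 ≤ s := hs ▸ by positivity
    by_cases hτs : τ < s
    · have hc' := hc.resolve_left hτs.not_ge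
      rw [if_pos hτs, logb_one_add_lt_iff (by positivity), div_lt_iff₀ (by linarith),
        add_comm (PB * w)]
      split_ifs with hlt
      · rfl
      -- Both sides fail: `s ≥ τ (1 + PB w) ≥ γF (1 + PB w)`, and `s > τ ≥ γF`.
      · have : γF * (1 + PB * w) ≤ τ * (1 + PB * w) := by
          have := not_lt.1 hlt
          gcongr
        constructor <;> intro h <;> linarith
    · rw [if_neg hτs, logb_one_add_lt_iff hs0]
      split_ifs with hlt
      -- Both sides hold, since `s ≤ τ < γF ≤ γF (1 + PB w)`.
      · have : 0 ≤ γF * (PB * w) := by positivity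
        constructor <;> intro h <;> linarith
      · rfl

theorem isBestUser_lt_iff {Ω : Type*} {K : ℕ} {PB Pm γB : ℝ} {g : Ω → ℂ} {h : Fin K → Ω → ℂ}
    {U : Ω → Fin K} (hU : IsBestUser PB Pm γB g h U) (R : ℝ) (ω : Ω) :
    ratePC PB Pm γB (g ω) (h (U ω) ω) < R ↔ ∀ k, ratePC PB Pm γB (g ω) (h k ω) < R :=
  ⟨fun hlt k => (hU ω k).trans_lt hlt, fun hall => hall (U ω)⟩

/-- For an independent family, the probability that all `V k` lie below a function of `W`. -/
theorem measure_forall_lt {Ω : Type*} [MeasurableSpace Ω] {μ : Measure Ω} [IsProbabilityMeasure μ]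
    {K : ℕ} {Y : Option (Fin K) → Ω → ℝ} (hY : iIndepFun Y μ) {ν ν' : Measure ℝ}
    [IsProbabilityMeasure ν]
    (hW : HasLaw (Y none) ν' μ) (hV : ∀ k, HasLaw (Y (some k)) ν μ) {b : ℝ → ℝ}
    (hb : Measurable b) :
    μ {ω | ∀ k, Y (some k) ω < b (Y none ω)} = ∫⁻ w, ν (Set.Iio (b w)) ^ K ∂ν' := by
  classical
  have hmeas : ∀ u, AEMeasurable (Y u) μ := fun u => by
    cases u with
    | none => exact hW.aemeasurable
    | some k => exact (hV k).aemeasurable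
  have hVm : AEMeasurable (fun ω k => Y (some k) ω) μ :=
    aemeasurable_pi_lambda _ fun k => hmeas (some k)
  have hind : IndepFun (Y none) (fun ω k => Y (some k) ω) μ := by
    -- Independence of the two disjoint blocks of indices, GB user and GF users; the subtype-indexed
    -- tuples are then relabelled by coordinate projections.
    have h := hY.indepFun_finset₀ {none} (Finset.univ.image some) (by simp) hmeas
    exact h.comp (φ := fun v : ↥({none} : Finset (Option (Fin K))) → ℝ => v ⟨none, by simp⟩)
      (ψ := fun (v : ↥(Finset.univ.image some : Finset (Option (Fin K))) → ℝ) (k : Fin K) =>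
        v ⟨some k, by simp⟩) (by fun_prop) (by fun_prop)
  have hpi : μ.map (fun ω k => Y (some k) ω) = Measure.pi fun _ => ν := by
    rw [(hY.precomp (Option.some_injective _)).map_fun_eq_pi_map fun k => hmeas (some k)]
    congr 1
    exact funext fun k => (hV k).map_eq
  have hjoint := (indepFun_iff_map_prod_eq_prod_map_map (hmeas none) hVm).1 hind
  rw [hpi, hW.map_eq] at hjoint
  have : IsProbabilityMeasure ν' := hW.map_eq ▸ Measure.isProbabilityMeasure_map hW.aemeasurable
  have hS : MeasurableSet {p : ℝ × (Fin K → ℝ) | ∀ k, p.2 k < b p.1} := by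
    simp only [Set.ofPred_forall]
    exact MeasurableSet.iInter fun k => measurableSet_lt (by fun_prop) (by fun_prop)
  change μ ((fun ω => (Y none ω, fun k => Y (some k) ω)) ⁻¹'
    {p : ℝ × (Fin K → ℝ) | ∀ k, p.2 k < b p.1}) = _
  rw [← Measure.map_apply_of_aemeasurable ((hmeas none).prodMk hVm) hS, hjoint]
  rw [Measure.prod_apply hS]
  refine lintegral_congr fun w => ?_
  rw [show Prod.mk w ⁻¹' {p : ℝ × (Fin K → ℝ) | ∀ k, p.2 k < b p.1} =
    Set.univ.pi fun _ => Set.Iio (b w) by ext v; simp, Measure.pi_pi]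
  simp

theorem cdfB_nonneg {α D0 D1 : ℝ} (hD0 : 0 ≤ D0) (hD1 : D0 < D1) {y : ℝ} (hy : 0 ≤ y) :
    0 ≤ cdfB α D0 D1 y := by
  refine mul_nonneg (div_nonneg (by norm_num) (by nlinarith)) ?_
  refine intervalIntegral.integral_nonneg hD1.le fun r hr => ?_
  have hr0 := hD0.trans hr.1
  have : Real.exp (-(1 + r ^ α) * y) ≤ 1 := by
    rw [Real.exp_le_one_iff, neg_mul, Left.neg_nonpos_iff]
    positivity
  exact mul_nonneg (by linarith) hr0

/-- Conditioning on the GB gain. That gain is almost surely nonnegative, which makes the level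
nonnegative, as the formula for the GF distribution function requires. -/
theorem outage_eq_integral {Ω : Type*} [MeasurableSpace Ω] {μ : Measure Ω} [IsProbabilityMeasure μ]
    {K : ℕ} {α DF D0 D1 PB Pm γB RF : ℝ} (hα : 0 < α) (hDF : 0 < DF) (hD0 : 0 < D0) (hD1 : D0 < D1)
    (hPB : 0 < PB) (hPm : 0 < Pm) (hγB : 0 < γB) (hRF : 0 < RF)
    {X : Fin K → Ω → Plane} {ζ : Fin K → Ω → ℂ} {XB : Ω → Plane} {ζB : Ω → ℂ}
    (hnet : IsNetwork μ K DF D0 D1 X ζ XB ζB) {U : Ω → Fin K}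
    (hU : IsBestUser PB Pm γB (fun ω => channel α (XB ω) (ζB ω))
      (fun k ω => channel α (X k ω) (ζ k ω)) U) :
    outage μ PB Pm γB RF (fun ω => channel α (XB ω) (ζB ω))
      (fun k ω => channel α (X k ω) (ζ k ω)) U =
    ∫ w, cdfF α DF (outageLevel PB Pm γB (targetSINR RF) w) ^ K ∂(gainLaw α D0 D1) := by
  have hγF := targetSINR_pos hRF
  have hprob := isProbabilityMeasure_gainLaw hα le_rfl hDF
  let Y : Option (Fin K) → Ω → ℝ := fun u ω =>
    gain α (u.elim (XB ω, ζB ω) fun k => (X k ω, ζ k ω))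
  have hY : iIndepFun Y μ := by
    exact hnet.indep_users.comp (fun _ => gain α) fun _ => measurable_gain α
  have hW : HasLaw (Y none) (gainLaw α D0 D1) μ :=
    hasLaw_gain hα hD0.le hD1 hnet.law_XB hnet.law_ζB hnet.indep_GB
  have hV : ∀ k, HasLaw (Y (some k)) (gainLaw α 0 DF) μ := fun k =>
    hasLaw_gain hα le_rfl hDF (disc_eq_ring DF ▸ hnet.law_X k) (hnet.law_ζ k) (hnet.indep_GF k)
  have hset : {ω | ratePC PB Pm γB (channel α (XB ω) (ζB ω))
      (channel α (X (U ω) ω) (ζ (U ω) ω)) < RF} =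
      {ω | ∀ k, Y (some k) ω < outageLevel PB Pm γB (targetSINR RF) (Y none ω)} := by
    ext ω
    exact (isBestUser_lt_iff hU RF ω).trans
      (forall_congr' fun k => ratePC_lt_iff hPB hPm hγB hRF _ _)
  have hlevel : ∀ w, 0 ≤ w → 0 ≤ outageLevel PB Pm γB (targetSINR RF) w := fun w hw => by
    unfold outageLevel αF
    split_ifs <;> positivity
  have hpos : ∀ᵐ w ∂(gainLaw α D0 D1), 0 ≤ w := by
    refine (withDensity_absolutelyContinuous _ _).ae_le ?_
    filter_upwards [ae_restrict_mem measurableSet_Ioi] with w hw using le_of_lt hw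
  have hmeas : Measurable fun w => cdfF α DF (outageLevel PB Pm γB (targetSINR RF) w) ^ K := by
    rw [cdfF_eq_cdfB]
    exact ((continuous_cdfB hα 0 DF).measurable.comp (measurable_outageLevel _ _ _ _)).pow_const K
  rw [outage, hset, measureReal_def,
    measure_forall_lt hY hW hV (measurable_outageLevel PB Pm γB (targetSINR RF)),
    integral_eq_lintegral_of_nonneg_ae _ hmeas.aestronglyMeasurable]
  · congr 1
    refine lintegral_congr_ae ?_
    filter_upwards [hpos] with w hw
    rw [gainLaw_Iio hα le_rfl hDF (hlevel w hw), cdfF_eq_cdfB,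
      ENNReal.ofReal_pow (cdfB_nonneg le_rfl hDF (hlevel w hw))]
  · filter_upwards [hpos] with w hw
    rw [cdfF_eq_cdfB]
    exact pow_nonneg (cdfB_nonneg le_rfl hDF (hlevel w hw)) K

/-- The sum over `k` of the terms `I1` is a single integral, by the binomial theorem. -/
theorem sum_I1 {F f : ℝ → ℝ} (hF : Continuous F) (hf : Continuous f) (PB γB γF PF : ℝ) (K : ℕ) :
    ∑ k ∈ Finset.range (K + 1), (K.choose k : ℝ) * I1 F f PB γB γF PF K k =
      ∫ w in (αB PB γB)..(α1 PB γB γF), integrand3 F f PB γF PF K w := by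
  simp_rw [I1, ← intervalIntegral.integral_const_mul]
  rw [← intervalIntegral.integral_finsetSum fun k _ =>
    ((continuous_integrand1 hF hf PB γB γF PF K k).const_mul _).intervalIntegrable _ _]
  exact intervalIntegral.integral_congr fun w _ =>
    integrand1_eq_integrand3_sum F f PB γB γF PF K w

/-- Split at `α1`: above it the integrand is constant and carries mass `1 - cdfB α1`; below it the
density turns the integrand into `integrand3`, integrated over `(0, α1)`. -/
theorem integral_gainLaw_eq_exactFormula {α DF D0 D1 PB Pm γB γF : ℝ} (hα : 0 < α)
    (hD0 : 0 ≤ D0) (hD1 : D0 < D1) (hPB : 0 < PB) (hγB : 0 < γB) (hγF : 0 < γF) (K : ℕ) :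
    ∫ w, cdfF α DF (outageLevel PB Pm γB γF w) ^ K ∂(gainLaw α D0 D1) =
      exactFormula (cdfF α DF) (pdfB α D0 D1) (cdfB α D0 D1) PB Pm γB γF K := by
  have hprob := isProbabilityMeasure_gainLaw hα hD0 hD1
  have hF : Continuous (cdfF α DF) := by rw [cdfF_eq_cdfB]; exact continuous_cdfB hα 0 DF
  have hf := continuous_pdfB hα D0 D1
  have hα1 : 0 ≤ α1 PB γB γF := by unfold α1 αB; positivity
  have hlow : Set.EqOn (fun w => cdfF α DF (outageLevel PB Pm γB γF w) ^ K)
      (fun w => cdfF α DF (αF Pm γF * PB * w + αF Pm γF) ^ K) (Set.Iio (α1 PB γB γF)) := by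
    intro w hw
    simp only [outageLevel, if_pos (Set.mem_Iio.1 hw)]
  have hhigh : Set.EqOn (fun w => cdfF α DF (outageLevel PB Pm γB γF w) ^ K)
      (fun _ => cdfF α DF (γF / Pm) ^ K) (Set.Iio (α1 PB γB γF))ᶜ := by
    intro w hw
    simp only [outageLevel, if_neg (fun h => hw (Set.mem_Iio.2 h))]
  have hrestrict : (gainLaw α D0 D1).restrict (Set.Iio (α1 PB γB γF)) =
      (volume.restrict (Set.Ioo 0 (α1 PB γB γF))).withDensity
        fun w => ENNReal.ofReal (pdfB α D0 D1 w) := by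
    rw [gainLaw, restrict_withDensity measurableSet_Iio,
      Measure.restrict_restrict measurableSet_Iio, Set.inter_comm, Set.Ioi_inter_Iio]
  have hdens : Measurable fun w => ENNReal.ofReal (pdfB α D0 D1 w) := by
    have := hf.measurable; fun_prop
  have hI3 : Continuous (integrand3 (cdfF α DF) (pdfB α D0 D1) PB γF Pm K) :=
    continuous_integrand3 hF hf _ _ _ _
  have hsmul : ∀ w, (ENNReal.ofReal (pdfB α D0 D1 w)).toReal •
      cdfF α DF (αF Pm γF * PB * w + αF Pm γF) ^ K =
      integrand3 (cdfF α DF) (pdfB α D0 D1) PB γF Pm K w := fun w => by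
    rw [ENNReal.toReal_ofReal (pdfB_nonneg hD0 hD1 w), smul_eq_mul, integrand3]
  have hlowint : IntegrableOn (fun w => cdfF α DF (outageLevel PB Pm γB γF w) ^ K)
      (Set.Iio (α1 PB γB γF)) (gainLaw α D0 D1) := by
    rw [integrableOn_congr_fun hlow measurableSet_Iio, IntegrableOn, hrestrict,
      integrable_withDensity_iff_integrable_smul' hdens
        (Eventually.of_forall fun w => ENNReal.ofReal_lt_top)]
    simp_rw [hsmul]
    exact hI3.integrableOn_Ioc.mono_set Set.Ioo_subset_Ioc_self
  have hhighint : IntegrableOn (fun w => cdfF α DF (outageLevel PB Pm γB γF w) ^ K)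
      (Set.Iio (α1 PB γB γF))ᶜ (gainLaw α D0 D1) := by
    rw [integrableOn_congr_fun hhigh measurableSet_Iio.compl]
    exact integrableOn_const (measure_ne_top _ _)
  rw [← integral_add_compl₀ measurableSet_Iio.nullMeasurableSet
      (by rw [← integrableOn_univ, ← Set.union_compl_self]; exact hlowint.union hhighint),
    setIntegral_congr_fun measurableSet_Iio hlow,
    setIntegral_congr_fun measurableSet_Iio.compl hhigh, setIntegral_const, hrestrict,
    integral_withDensity_eq_integral_toReal_smul hdens
      (Eventually.of_forall fun w => ENNReal.ofReal_lt_top)]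
  simp_rw [hsmul]
  rw [probReal_compl_eq_one_sub measurableSet_Iio, measureReal_def,
    gainLaw_Iio hα hD0 hD1 hα1, ENNReal.toReal_ofReal (cdfB_nonneg hD0 hD1 hα1),
    ← integral_Ioc_eq_integral_Ioo, ← intervalIntegral.integral_of_le hα1, exactFormula,
    sum_I1 hF hf, I3, I5, smul_eq_mul, add_comm (∫ w in (αB PB γB)..(α1 PB γB γF), _),
    intervalIntegral.integral_add_adjacent_intervals (hI3.intervalIntegrable _ _)
      (hI3.intervalIntegrable _ _)]

/-! ### Joint limits in several numbers of nodes -/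

theorem tendsto_fst_atTop {β γ : Type*} [Preorder β] [Preorder γ] :
    Tendsto (Prod.fst : β × γ → β) atTop atTop := by
  rw [← prod_atTop_atTop_eq]; exact tendsto_fst

theorem tendsto_snd_atTop {β γ : Type*} [Preorder β] [Preorder γ] :
    Tendsto (Prod.snd : β × γ → γ) atTop atTop := by
  rw [← prod_atTop_atTop_eq]; exact tendsto_snd

theorem tendstoLocallyUniformly_comp {ι κ : Type*} {l : Filter ι} {l' : Filter κ}
    {F : κ → ℝ → ℝ} {F₀ : ℝ → ℝ} (hF : TendstoLocallyUniformly F F₀ l') {m : ι → κ}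
    (hm : Tendsto m l l') : TendstoLocallyUniformly (fun i => F (m i)) F₀ l :=
  fun u hu x => (hF u hu x).imp fun _ ht => ⟨ht.1, hm.eventually ht.2⟩

end SGF

end

theorem theorem3 {Ω : Type*} [MeasurableSpace Ω] (μ : Measure Ω) [IsProbabilityMeasure μ]
    (K : ℕ) (hK : 1 ≤ K)
    (α DF D0 D1 PB Pm RB RF : ℝ)
    (hα : 0 < α) (hDF : 0 < DF) (hD0 : 0 < D0) (hD1 : D0 < D1)
    (hPB : 0 < PB) (hPm : 0 < Pm) (hRB : 0 < RB) (hRF : 0 < RF)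
    (X : Fin K → Ω → SGF.Plane) (ζ : Fin K → Ω → ℂ) (XB : Ω → SGF.Plane) (ζB : Ω → ℂ)
    (hnet : SGF.IsNetwork μ K DF D0 D1 X ζ XB ζB)
    (γB γF : ℝ) (hγB : γB = SGF.targetSINR RB) (hγF : γF = SGF.targetSINR RF)
    (g : Ω → ℂ) (hg : g = fun ω => SGF.channel α (XB ω) (ζB ω))
    (h : Fin K → Ω → ℂ) (hh : h = fun k ω => SGF.channel α (X k ω) (ζ k ω))
    (U : Ω → Fin K) (hU : SGF.IsBestUser PB Pm γB g h U) :
    -- the exact expression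
    SGF.outage μ PB Pm γB RF g h U =
      SGF.exactFormula (SGF.cdfF α DF) (SGF.pdfB α D0 D1) (SGF.cdfB α D0 D1) PB Pm γB γF K ∧
    -- the quadrature expression with the exact distribution functions
    Tendsto (fun n : ℕ × ℕ =>
        SGF.quadFormula (SGF.cdfF α DF) (SGF.pdfB α D0 D1) (SGF.cdfB α D0 D1)
          PB Pm γB γF K n.1 n.2)
      atTop (𝓝 (SGF.outage μ PB Pm γB RF g h U)) ∧
    -- the quadrature expression with the approximate distribution functions
    Tendsto (fun n : ℕ × ℕ × ℕ × ℕ =>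
        SGF.quadFormula (SGF.cdfFApprox α DF n.1) (SGF.pdfBApprox α D0 D1 n.2.1)
          (SGF.cdfBApprox α D0 D1 n.2.1) PB Pm γB γF K n.2.2.1 n.2.2.2)
      atTop (𝓝 (SGF.outage μ PB Pm γB RF g h U)) := by
  have hγB0 : 0 < γB := hγB ▸ SGF.targetSINR_pos hRB
  have hγF0 : 0 < γF := hγF ▸ SGF.targetSINR_pos hRF
  subst hg hh hγF
  have hexact := (SGF.outage_eq_integral hα hDF hD0 hD1 hPB hPm hγB0 hRF hnet hU).trans
    (SGF.integral_gainLaw_eq_exactFormula hα hD0.le hD1 hPB hγB0 hγF0 K)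
  have hF : Continuous (SGF.cdfF α DF) := by
    rw [SGF.cdfF_eq_cdfB]; exact SGF.continuous_cdfB hα 0 DF
  have hf := SGF.continuous_pdfB hα D0 D1
  have hαB : 0 ≤ SGF.αB PB γB := div_nonneg hγB0.le hPB.le
  have hconst : ∀ (φ : ℝ → ℝ), Continuous φ →
      TendstoLocallyUniformly (fun _ : ℕ × ℕ => φ) φ atTop := fun φ hφ => by
    rw [SGF.tendstoLocallyUniformly_iff_tendsto_nhds hφ]
    exact fun x => (hφ.tendsto x).comp tendsto_snd
  have hFB := SGF.continuous_cdfB hα D0 D1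
  rw [hexact]
  refine ⟨rfl, ?_, ?_⟩
  · exact SGF.quadFormula_tendsto hF hf (hconst _ hF) (hconst _ hf) (hconst _ hFB) hαB hγF0.le K
      SGF.tendsto_fst_atTop SGF.tendsto_snd_atTop
  -- The components of `n` are `(L, N, I, M)`; the same `N` serves the density and the distribution
  -- function of the GB gain.
  · have h2 : Tendsto (fun n : ℕ × ℕ × ℕ × ℕ => n.2) atTop atTop := SGF.tendsto_snd_atTop
    have h3 : Tendsto (fun n : ℕ × ℕ × ℕ × ℕ => n.2.2) atTop atTop :=
      SGF.tendsto_snd_atTop.comp h2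
    have hN := SGF.tendsto_fst_atTop.comp h2
    exact SGF.quadFormula_tendsto hF hf
      (SGF.tendstoLocallyUniformly_comp (SGF.cdfFApprox_tendsto hα hDF) SGF.tendsto_fst_atTop)
      (SGF.tendstoLocallyUniformly_comp (SGF.pdfBApprox_tendsto hα hD0 hD1) hN)
      (SGF.tendstoLocallyUniformly_comp (SGF.cdfBApprox_tendsto hα hD0 hD1) hN)
      hαB hγF0.le K (SGF.tendsto_fst_atTop.comp h3) (SGF.tendsto_snd_atTop.comp h3)
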